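/- Let $q$ be a prime power, let $k\ge 2$, and let $\mathcal D=\{x_1,\dots,x_{k+3}\}$ be a set of $k+3$ distinct ordered points of $PG(1,q)=GF(q)\cup\{\infty\}$ (so $k\le q-2$). **The code.** The $[k+3,k,\mathcal D]_q$ Reed–Solomon code $\mathcal C$ consists of the words $(f(x_1),\dots,f(x_{k+3}))$, where $f\in GF(q)[X]$ has degree at most $k-1$ and $f(\infty)$ means the coefficient of $X^{k-1}$ in $f$. A deep hole of $\mathcal C$ is a word $u\in GF(q)^{k+3}$ whose Hamming distance from $\mathcal C$ equals the covering radius of $\mathcal C$, that is, the maximum over all words of the distance from $\mathcal C$. **Syndromes.** Put $c_m(x)=(1,x,\dots,x^{m-1})^T$ for $x\in GF(q)$ and $c_m(\infty)=(0,\dots,0,1)^T$. Let $S_{\mathcal D}(u)=[\nu_1c_3(x_1)\,|\cdots|\,\nu_{k+3}c_3(x_{k+3})]\,u\in GF(q)^3$, where $\nu_j=\prod_{i\ne j}\det[c_2(x_i)\,|\,c_2(x_j)]^{-1}$. (Thus $\nu_j=\prod_{i\neq j}(x_j-x_i)^{-1}$ if $\infty\notin\mathcal D$, and $\nu_j=1$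 for all $j$ if $\mathcal D=PG(1,q)$.) For $v\ne0$, $[v]$ denotes the point of $PG(2,q)$ represented by $v$. **Group actions.** For $g=\begin{pmatrix}a&b\\c&d\end{pmatrix}\in GL(2,q)$ let $g\cdot x=(c+dx)/(a+bx)$ on $PG(1,q)$, and $$g\cdot\xi=\begin{pmatrix}a^2&2ab&b^2\\ ac&ad+bc&bd\\ c^2&2cd&d^2\end{pmatrix}\xi\qquad(\xi\in GF(q)^3).$$ These induce actions of $PGL(2,q)$ on $PG(1,q)$ and on $PG(2,q)$. For $q$ odd fix a non-square $\epsilon\in GF(q)$, and let $\mathcal O_2,\mathcal O_3$ be the $PGL(2,q)$-orbits of $(0:1:0)$ and of $(1:0:-\epsilon)$ respectively. **The sets $\mathcal O_i(\mathcal D)$.** With the conventions $-\infty=\infty$, $e/0=\infty$, $e/\infty=0$ for $e\neq 0$, define - $\mathcal O_1(\mathcal D)=\{[c_3(\delta)]:\delta\in PG(1,q)\setminus\mathcal D\}$ if $q$ is odd, and this set together with $(0:1:0)$ if $q$ is even; - $\mathcal O_2(\mathcal D)$ ($q$ odd): the points $g\cdot(0:1:0)$ with $g\in PGL(2,q)$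 such that $x\neq -y$ for all distinct $x,y\in g^{-1}\cdot\mathcal D$; - $\mathcal O_3(\mathcal D)$ ($q$ odd): the points $g\cdot(1:0:-\epsilon)$ with $g\in PGL(2,q)$ such that $x\neq \epsilon/y$ for all distinct $x,y\in g^{-1}\cdot\mathcal D$; - $\mathcal O_4(\mathcal D)$ ($q$ even): the points $g\cdot(1:0:1)$ with $g\in PGL(2,q)$ such that $x\neq 1/y$ for all distinct $x,y\in g^{-1}\cdot\mathcal D$. **Theorem.** Every deep hole $u$ of $\mathcal C$ has $S_{\mathcal D}(u)\neq0$, and the set $\{[S_{\mathcal D}(u)]: u \text{ a deep hole of }\mathcal C\}\subseteq PG(2,q)$ of projective syndromes of deep holes is equal to: 1. $\{(0:1:0)\}$ if $k=q-2$ and $q$ is even; $\mathcal O_2\cup\mathcal O_3$ if $k=q-2$ and $q$ is odd; 2. $\mathcal O_1(\mathcal D)$ if $\lfloor (q-1)/2\rfloor\le k\le q-3$; 3. $\mathcal O_1(\mathcal D)\cup\mathcal O_2(\mathcal D)$ if $q$ is odd and $k=(q-3)/2$; 4. $\mathcal O_1(\mathcal D)\cup\mathcal O_2(\mathcal D)\cup\mathcal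 O_3(\mathcal D)$ if $q$ is odd and $2\le k\le (q-5)/2$; 5. $\mathcal O_1(\mathcal D)\cup\mathcal O_4(\mathcal D)$ if $q$ is even and $2\le k\le (q-4)/2$. -/

import Mathlib

open scoped LinearAlgebra.Projectivization Matrix MatrixGroups OnePoint

namespace RSDeepHoles

noncomputable section

section Codes

variable {F : Type*} [DecidableEq F] {n : ℕ}

/-- Hamming distance from a received word `u` to a (nonempty) code `C`. -/
def distToCode (C : Set (Fin n → F)) (u : Fin n → F) : ℕ :=
  sInf ((fun c => hammingDist u c) '' C)

/-- Covering radius of `C`: the largest distance of a received word from `C`. -/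
def coveringRadius (C : Set (Fin n → F)) : ℕ :=
  sSup (Set.range (distToCode C))

/-- A deep hole: a received word whose distance from `C` attains the covering radius. -/
def IsDeepHole (C : Set (Fin n → F)) (u : Fin n → F) : Prop :=
  distToCode C u = coveringRadius C

end Codes

section RS

variable {F : Type*} [Field F]

/-- Value of a message polynomial of degree `< k` at a point of `PG(1,q) = F ∪ {∞}`;
the value at `∞` is the coefficient of `X ^ (k - 1)`. -/
def evalAt (k : ℕ) (f : Polynomial F) (x : OnePoint F) : F :=
  x.elim (f.coeff (k - 1)) (fun t => f.eval t)

/-- The `[n, k]` Reed-Solomon code with evaluation points `D 0, …, D (n - 1)` in `PG(1,q)`. -/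
def rsCode (k : ℕ) {n : ℕ} (D : Fin n → OnePoint F) : Set (Fin n → F) :=
  {w | ∃ f : Polynomial F, f.degree < k ∧ ∀ i, w i = evalAt k f (D i)}

/-- `c_m(x) = (1, x, …, x ^ (m-1))` for `x` in `F`, and `c_m(∞) = (0, …, 0, 1)`. -/
def rncVec (m : ℕ) (x : OnePoint F) : Fin m → F :=
  x.elim (fun i => if (i : ℕ) + 1 = m then 1 else 0) (fun t i => t ^ (i : ℕ))

/-- The determinant of the `2 × 2` matrix with columns `c_2(x)`, `c_2(y)`.
For finite `x`, `y` it is `y - x`. -/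
def bracket (x y : OnePoint F) : F :=
  rncVec 2 x 0 * rncVec 2 y 1 - rncVec 2 x 1 * rncVec 2 y 0

/-- The column multiplier `ν_j`. If all evaluation points are finite this is
`∏_{i ≠ j} (x_j - x_i)⁻¹` (`colMul_of_finite`), and it is `1` for every `j` if the evaluation
points are all the points of `PG(1,q)` (`colMul_of_bijective`). -/
def colMul {n : ℕ} (D : Fin n → OnePoint F) (j : Fin n) : F :=
  ∏ i ∈ Finset.univ.erase j, (bracket (D i) (D j))⁻¹

/-- The parity check matrix `[ν_1 c_r(x_1) | … | ν_n c_r(x_n)]` of the Reed-Solomon code of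
length `n` and redundancy `r`. -/
def parityCheck (r : ℕ) {n : ℕ} (D : Fin n → OnePoint F) : Matrix (Fin r) (Fin n) F :=
  Matrix.of fun a j => colMul D j * rncVec r (D j) a

/-- The syndrome of `u`. -/
def syndrome (r : ℕ) {n : ℕ} (D : Fin n → OnePoint F) (u : Fin n → F) : Fin r → F :=
  parityCheck r D *ᵥ u

/-- The set of projective syndromes, in `PG(r-1,q)`, of the deep holes of the `[n, k]`
Reed-Solomon code with evaluation points `D`, where `r = n - k`. -/
def deepHoleSyndromes [DecidableEq F] (r k : ℕ) {n : ℕ} (D : Fin n → OnePoint F) :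
    Set (ℙ F (Fin r → F)) :=
  {P | ∃ u : Fin n → F, IsDeepHole (rsCode k D) u ∧
    ∃ h : syndrome r D u ≠ 0, P = Projectivization.mk F (syndrome r D u) h}

theorem colMul_of_finite {n : ℕ} (x : Fin n → F) (j : Fin n) :
    colMul (fun i => (x i : OnePoint F)) j =
      ∏ i ∈ Finset.univ.erase j, (x j - x i)⁻¹ := by
  simp [colMul, bracket, rncVec]

theorem colMul_of_bijective [Fintype F] {n : ℕ} (D : Fin n → OnePoint F)
    (hD : Function.Bijective D) (j : Fin n) : colMul D j = 1 := by
  classical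
  have key : ∀ y : OnePoint F,
      ∏ x ∈ (Finset.univ : Finset (Option F)).erase y, bracket (F := F) x y = 1 := by
    intro y
    have hb1 : ∀ t : F, bracket (t : OnePoint F) ∞ = 1 := by
      intro t; simp [bracket, rncVec]
    have hb2 : ∀ t : F, bracket ∞ (t : OnePoint F) = -1 := by
      intro t; simp [bracket, rncVec]
    have hb3 : ∀ s t : F, bracket (s : OnePoint F) (t : OnePoint F) = t - s := by
      intro s t; simp [bracket, rncVec]
    induction y using OnePoint.rec with
    | infty =>
      refine Finset.prod_eq_one fun x hx => ?_
      cases x with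
      | none => exact absurd rfl (Finset.ne_of_mem_erase hx)
      | some t => exact hb1 t
    | coe t =>
      have e : (Finset.univ : Finset (Option F)).erase (some t) =
          insert none (((Finset.univ : Finset F).erase t).map Function.Embedding.some) := by
        ext x; cases x <;> simp
      have e' : ∏ x ∈ ((Finset.univ : Finset F).erase t), (t - x) = -1 := by
        have w := congrArg (fun u : Fˣ => (u : F))
          (FiniteField.prod_univ_units_id_eq_neg_one (K := F))
        simp only [Units.coe_prod, Units.val_neg, Units.val_one] at w
        rw [← w]
        symm
        refine Finset.prod_bij (fun u _ => t - (u : F)) ?_ ?_ ?_ ?_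
        · intro u _; simp
        · intro u _ v _ h; exact Units.ext (sub_right_injective h)
        · intro b hb
          have hne : t - b ≠ 0 := sub_ne_zero.mpr (Finset.ne_of_mem_erase hb).symm
          exact ⟨Units.mk0 _ hne, Finset.mem_univ _, by simp⟩
        · intro u _; simp
      change ∏ x ∈ (Finset.univ : Finset (Option F)).erase (some t), _ = _
      rw [e, Finset.prod_insert (by simp), Finset.prod_map]
      change bracket ∞ (t : OnePoint F) *
        ∏ x ∈ (Finset.univ : Finset F).erase t, bracket (x : OnePoint F) (t : OnePoint F) = 1
      simp only [hb2, hb3, e']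
      ring
  have h1 : ∏ i ∈ Finset.univ.erase j, bracket (D i) (D j) = 1 := by
    rw [← key (D j)]
    refine Finset.prod_bij (fun i _ => D i) ?_ ?_ ?_ ?_
    · intro i hi
      exact Finset.mem_erase.2 ⟨fun h => Finset.ne_of_mem_erase hi (hD.1 h), Finset.mem_univ _⟩
    · intro a _ b _ h; exact hD.1 h
    · intro b hb
      obtain ⟨i, rfl⟩ := hD.2 b
      exact ⟨i, Finset.mem_erase.2
        ⟨fun h => Finset.ne_of_mem_erase hb (by rw [h]), Finset.mem_univ _⟩, rfl⟩
    · intro _ _; rfl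
  rw [colMul, Finset.prod_inv_distrib, h1, inv_one]

end RS

section Plane

variable {F : Type*} [Field F]

theorem vec3_ne_zero {v : Fin 3 → F} (i : Fin 3) (h : v i ≠ 0) : v ≠ 0 :=
  fun hv => h (by rw [hv]; rfl)

/-- The point `[c_3(x)]` of the standard rational normal curve (conic) in `PG(2,q)`. -/
def conicPoint (x : OnePoint F) : ℙ F (Fin 3 → F) :=
  Projectivization.mk F (rncVec 3 x) (by
    induction x using OnePoint.rec with
    | infty => exact vec3_ne_zero 2 (by simp [rncVec])
    | coe t => exact vec3_ne_zero 0 (by simp [rncVec]))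

/-- The point `(0 : 1 : 0)`. -/
def nucleus (F : Type*) [Field F] : ℙ F (Fin 3 → F) :=
  Projectivization.mk F ![0, 1, 0] (vec3_ne_zero 1 (by simp))

/-- The point `(1 : 0 : e)`. -/
def point10 (e : F) : ℙ F (Fin 3 → F) :=
  Projectivization.mk F ![1, 0, e] (vec3_ne_zero 0 (by simp))

/-- The matrix by which `g = [[a, b], [c, d]]` acts on `F³`. -/
def symSqMatrix (g : Matrix (Fin 2) (Fin 2) F) : Matrix (Fin 3) (Fin 3) F :=
  !![g 0 0 ^ 2, 2 * g 0 0 * g 0 1, g 0 1 ^ 2;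
     g 0 0 * g 1 0, g 0 0 * g 1 1 + g 1 0 * g 0 1, g 0 1 * g 1 1;
     g 1 0 ^ 2, 2 * g 1 0 * g 1 1, g 1 1 ^ 2]

/-- The same as a group homomorphism `GL(2,q) → GL(3,q)`. It maps scalars to scalars, so that
`symSq g • P` is the action of the class of `g` in `PGL(2,q)` on the point `P` of `PG(2,q)`. -/
def symSq : GL (Fin 2) F →* GL (Fin 3) F :=
  Units.map
    { toFun := symSqMatrix
      map_one' := by
        ext i j; fin_cases i <;> fin_cases j <;> simp [symSqMatrix]
      map_mul' := by
        intro g h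
        ext i j
        fin_cases i <;> fin_cases j <;>
          simp [symSqMatrix, Matrix.mul_apply, Fin.sum_univ_succ] <;> ring }

/-- The orbit of the point `P` of `PG(2,q)` under `PGL(2,q)`. -/
def pglOrbit (P : ℙ F (Fin 3 → F)) : Set (ℙ F (Fin 3 → F)) :=
  Set.range fun g : GL (Fin 2) F => symSq g • P

/-- The orbit `O₂` of `(0 : 1 : 0)`. -/
def O2 (F : Type*) [Field F] : Set (ℙ F (Fin 3 → F)) := pglOrbit (nucleus F)

/-- The orbit `O₃` of `(1 : 0 : -ε)`. -/
def O3 (ε : F) : Set (ℙ F (Fin 3 → F)) := pglOrbit (point10 (-ε))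

section Line

variable [DecidableEq F]

/-- The fractional linear action `x ↦ (c + d x) / (a + b x)` on `PG(1,q) = F ∪ {∞}` of
`g = [[a, b], [c, d]]`, that is, `[c_2(x)] ↦ [g c_2(x)]`. -/
def moebius (g : GL (Fin 2) F) (x : OnePoint F) : OnePoint F :=
  x.elim (if g 0 1 = 0 then ∞ else ((g 1 1 / g 0 1 : F) : OnePoint F))
    (fun t => if g 0 0 + g 0 1 * t = 0 then ∞
      else (((g 1 0 + g 1 1 * t) / (g 0 0 + g 0 1 * t) : F) : OnePoint F))

/-- `x ↦ -x` on `F ∪ {∞}`, with `-∞ = ∞`. -/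
def negPt (x : OnePoint F) : OnePoint F := x.map (fun t => -t)

/-- `x ↦ e / x` on `F ∪ {∞}` for `e ≠ 0`, with `e / 0 = ∞` and `e / ∞ = 0`. -/
def divPt (e : F) (x : OnePoint F) : OnePoint F :=
  x.elim ((0 : F) : OnePoint F) (fun t => if t = 0 then ∞ else ((e / t : F) : OnePoint F))

/-- `O₁(D)`: the points of the conic with parameter outside `D`, together with the nucleus
`(0 : 1 : 0)` if `q` is even. -/
def O1D [Fintype F] (D : Set (OnePoint F)) : Set (ℙ F (Fin 3 → F)) :=
  {P | (∃ δ : OnePoint F, δ ∉ D ∧ P = conicPoint δ) ∨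
    (Even (Fintype.card F) ∧ P = nucleus F)}

/-- `O₂(D)`: the points `g · (0 : 1 : 0)`, where `g` is such that distinct `x`, `y` in `g⁻¹ · D`
satisfy `x ≠ -y`. -/
def O2D (D : Set (OnePoint F)) : Set (ℙ F (Fin 3 → F)) :=
  {P | ∃ g : GL (Fin 2) F, P = symSq g • nucleus F ∧
    ∀ x ∈ moebius g⁻¹ '' D, ∀ y ∈ moebius g⁻¹ '' D, x ≠ y → x ≠ negPt y}

/-- `O₃(D)`: the points `g · (1 : 0 : -ε)`, where `g` is such that distinct `x`, `y` in `g⁻¹ · D`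
satisfy `x ≠ ε / y`. -/
def O3D (ε : F) (D : Set (OnePoint F)) : Set (ℙ F (Fin 3 → F)) :=
  {P | ∃ g : GL (Fin 2) F, P = symSq g • point10 (-ε) ∧
    ∀ x ∈ moebius g⁻¹ '' D, ∀ y ∈ moebius g⁻¹ '' D, x ≠ y → x ≠ divPt ε y}

/-- `O₄(D)`: the points `g · (1 : 0 : 1)`, where `g` is such that distinct `x`, `y` in `g⁻¹ · D`
satisfy `x ≠ 1 / y`. -/
def O4D (D : Set (OnePoint F)) : Set (ℙ F (Fin 3 → F)) :=
  {P | ∃ g : GL (Fin 2) F, P = symSq g • point10 (1 : F) ∧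
    ∀ x ∈ moebius g⁻¹ '' D, ∀ y ∈ moebius g⁻¹ '' D, x ≠ y → x ≠ divPt 1 y}

end Line

end Plane

end

end RSDeepHoles

/-!
The code is the kernel of its parity check matrix, so the distance of a word from the code is the
least number of columns of that matrix whose span contains the syndrome. The columns are points of a
conic in the plane, any three of which are independent, so this distance is at most `3`, and it
equals `3` exactly when the syndrome is on no line joining two points of the conic with parameters
in `D` (`distToCode_eq_three_iff`). That the parity checks vanish on the code is Lagrange
interpolation (`sum_colMul_mul_eq_zero`); equality with the kernel follows by comparing dimensions.

Incidence with secants is expressed by the symmetric bilinear form `polar s` on `F²`: the vector `s`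
is on the line through the conic points with distinct parameters `x` and `y` if and only if
`polar s x y = 0`. This form is equivariant under `GL(2)` up to nonzero factors, and for the orbit
representatives `(0 : 1 : 0)` and `(1 : 0 : -ε)` it vanishes when `x = -y` and when `x = ε / y`,
respectively. Hence `O₂(D)`, `O₃(D)` and `O₄(D)` are the intersections of the corresponding orbits
with the set `secantFree D` of points on no secant (`O2D_eq`, `O3D_eq`).

In odd characteristic the plane is the union of the conic, `O₂` and `O₃`, according to whether the
conic form is zero, a nonzero square or a nonsquare; in characteristic `2` it is the union of the
conic, the nucleus and the orbit of `(1 : 0 : 1)`. Intersecting with `secantFree D` gives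
`secantFree_eq_of_odd` and `secantFree_eq_of_even`. If `D` contains no two distinct points
interchanged by an involution of the line with `f` fixed points, then `2 |D| ≤ q + 1 + f`
(`two_mul_card_le`); with `f = 2, 0, 1` for `O₂`, `O₃`, `O₄` this makes the corresponding parts
empty for large `k`.

The covering radius is `3` as soon as `secantFree D` is nonempty, and the deep holes are then the
words with syndrome in `secantFree D`. The set is empty only if `q` is odd and `D` is the whole
line; in that case the covering radius is `2` and the deep holes are the words with syndrome off the
conic.
-/

namespace RSDeepHoles

/-! ### Polar forms of plane points -/

section Polar

variable {F : Type*} [Field F]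

/-- The symmetric bilinear form on `F²` attached to `s ∈ F³`. At the homogeneous coordinates of
distinct parameters `x` and `y` it vanishes exactly when `s` is on the line joining the
corresponding points of the conic. -/
def polar (s : Fin 3 → F) (v w : Fin 2 → F) : F :=
  s 0 * (v 1 * w 1) - s 1 * (v 0 * w 1 + v 1 * w 0) + s 2 * (v 0 * w 0)

/-- The quadratic form on `F³` whose zeros are the points of the conic; it is also the
discriminant (up to a factor `4`) of the binary form `polar s v v`. -/
def conicForm (s : Fin 3 → F) : F := s 1 ^ 2 - s 0 * s 2

theorem rncVec_three (x : OnePoint F) :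
    rncVec 3 x = ![rncVec 2 x 0 ^ 2, rncVec 2 x 0 * rncVec 2 x 1, rncVec 2 x 1 ^ 2] := by
  induction x using OnePoint.rec <;> ext i <;> fin_cases i <;> simp [rncVec]

theorem bracket_coe_coe (s t : F) : bracket (s : OnePoint F) (t : OnePoint F) = t - s := by
  simp [bracket, rncVec]

theorem bracket_coe_infty (t : F) : bracket (t : OnePoint F) ∞ = 1 := by
  simp [bracket, rncVec]

theorem bracket_infty_coe (t : F) : bracket ∞ (t : OnePoint F) = -1 := by
  simp [bracket, rncVec]

theorem bracket_self (x : OnePoint F) : bracket x x = 0 := by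
  rw [bracket]; ring

theorem bracket_ne_zero {x y : OnePoint F} (h : x ≠ y) : bracket x y ≠ 0 := by
  induction x using OnePoint.rec with
  | infty =>
    induction y using OnePoint.rec with
    | infty => exact absurd rfl h
    | coe t => simp [bracket_infty_coe]
  | coe s =>
    induction y using OnePoint.rec with
    | infty => simp [bracket_coe_infty]
    | coe t =>
      rw [bracket_coe_coe, sub_ne_zero]
      rintro rfl
      exact h rfl

theorem polar_comm (s : Fin 3 → F) (v w : Fin 2 → F) : polar s v w = polar s w v := by
  simp only [polar]; ring

theorem polar_add (s t : Fin 3 → F) (v w : Fin 2 → F) :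
    polar (s + t) v w = polar s v w + polar t v w := by
  simp only [polar, Pi.add_apply]; ring

theorem polar_smul (a : F) (s : Fin 3 → F) (v w : Fin 2 → F) :
    polar (a • s) v w = a * polar s v w := by
  simp only [polar, Pi.smul_apply, smul_eq_mul]; ring

theorem polar_smul_smul (a b : F) (s : Fin 3 → F) (v w : Fin 2 → F) :
    polar s (a • v) (b • w) = a * b * polar s v w := by
  simp only [polar, Pi.smul_apply, smul_eq_mul]; ring

theorem polar_rncVec (x y z : OnePoint F) :
    polar (rncVec 3 z) (rncVec 2 x) (rncVec 2 y) = bracket z x * bracket z y := by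
  rw [rncVec_three]; simp [polar, bracket]; ring

theorem conicForm_smul (a : F) (s : Fin 3 → F) : conicForm (a • s) = a ^ 2 * conicForm s := by
  simp only [conicForm, Pi.smul_apply, smul_eq_mul]; ring

theorem conicForm_rncVec (x : OnePoint F) : conicForm (rncVec 3 x) = 0 := by
  rw [rncVec_three]; simp [conicForm]; ring

/-- A vector whose polar form vanishes at two distinct parameters is a combination of the
corresponding two points of the conic, by Cramer's rule. -/
theorem exists_eq_add_of_polar_eq_zero {s : Fin 3 → F} {x y : OnePoint F} (hxy : x ≠ y)
    (h : polar s (rncVec 2 x) (rncVec 2 y) = 0) :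
    ∃ a b : F, s = a • rncVec 3 x + b • rncVec 3 y := by
  have hb := bracket_ne_zero hxy
  refine ⟨polar s (rncVec 2 y) (rncVec 2 y) / bracket x y ^ 2,
    polar s (rncVec 2 x) (rncVec 2 x) / bracket x y ^ 2, ?_⟩
  have key : bracket x y ^ 2 • s = polar s (rncVec 2 y) (rncVec 2 y) • rncVec 3 x +
      polar s (rncVec 2 x) (rncVec 2 x) • rncVec 3 y := by
    rw [rncVec_three, rncVec_three]
    simp only [polar, bracket] at h ⊢
    ext i
    fin_cases i <;> simp
    · linear_combination (-2 * rncVec 2 x 0 * rncVec 2 y 0) * h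
    · linear_combination (-(rncVec 2 x 0 * rncVec 2 y 1 + rncVec 2 x 1 * rncVec 2 y 0)) * h
    · linear_combination (-2 * rncVec 2 x 1 * rncVec 2 y 1) * h
  rw [div_eq_inv_mul, div_eq_inv_mul, mul_smul, mul_smul, ← smul_add, ← key, smul_smul,
    inv_mul_cancel₀ (pow_ne_zero 2 hb), one_smul]

/-- Any three points of the conic span the plane. -/
theorem exists_eq_add_add {x y z : OnePoint F} (hxy : x ≠ y) (hxz : x ≠ z) (hyz : y ≠ z)
    (s : Fin 3 → F) :
    ∃ a b c : F, s = a • rncVec 3 x + b • rncVec 3 y + c • rncVec 3 z := by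
  have hx := bracket_ne_zero hxz.symm
  have hy := bracket_ne_zero hyz.symm
  -- The multiple of `z` to be removed so that the rest is on the line through `x` and `y`.
  set c := polar s (rncVec 2 x) (rncVec 2 y) / (bracket z x * bracket z y) with hc
  obtain ⟨a, b, h⟩ := exists_eq_add_of_polar_eq_zero (s := s + (-c) • rncVec 3 z) hxy (by
    rw [polar_add, polar_smul, polar_rncVec, hc]; field_simp; ring)
  exact ⟨a, b, c, by rw [← h]; simp⟩

theorem polar_symSqMatrix (g : Matrix (Fin 2) (Fin 2) F) (s : Fin 3 → F) (v w : Fin 2 → F) :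
    polar (symSqMatrix g *ᵥ s) (g *ᵥ v) (g *ᵥ w) = g.det ^ 2 * polar s v w := by
  simp [polar, symSqMatrix, Matrix.mulVec, dotProduct, Fin.sum_univ_succ, Matrix.det_fin_two]
  ring

theorem conicForm_symSqMatrix (g : Matrix (Fin 2) (Fin 2) F) (s : Fin 3 → F) :
    conicForm (symSqMatrix g *ᵥ s) = g.det ^ 2 * conicForm s := by
  simp [conicForm, symSqMatrix, Matrix.mulVec, dotProduct, Fin.sum_univ_succ, Matrix.det_fin_two]
  ring

theorem exists_eq_smul_rncVec_of_conicForm_eq_zero {s : Fin 3 → F} (h : conicForm s = 0) :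
    ∃ (a : F) (x : OnePoint F), s = a • rncVec 3 x := by
  rw [conicForm] at h
  by_cases h0 : s 0 = 0
  · refine ⟨s 2, ∞, ?_⟩
    have h1 : s 1 = 0 := by simpa [h0] using h
    ext i; fin_cases i <;> simp [rncVec, h0, h1]
  · refine ⟨s 0, ((s 1 / s 0 : F) : OnePoint F), ?_⟩
    ext i; fin_cases i <;> simp [rncVec]
    · field_simp
    · field_simp; linear_combination -h

theorem polar_nucleus_eq_zero_iff (x y : OnePoint F) :
    polar ![0, 1, 0] (rncVec 2 x) (rncVec 2 y) = 0 ↔ x = negPt y := by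
  induction x using OnePoint.rec <;> induction y using OnePoint.rec <;>
    simp [polar, rncVec, negPt]
  rw [← neg_add, neg_eq_zero, eq_neg_iff_add_eq_zero]

variable [DecidableEq F]

theorem exists_mulVec_rncVec (g : GL (Fin 2) F) (x : OnePoint F) :
    ∃ l : F, l ≠ 0 ∧ g.1 *ᵥ rncVec 2 x = l • rncVec 2 (moebius g x) := by
  have hdet : g 0 0 * g 1 1 - g 0 1 * g 1 0 ≠ 0 := by
    rw [← Matrix.det_fin_two]; exact g.det.ne_zero
  induction x using OnePoint.rec with
  | infty =>
    by_cases h : g 0 1 = 0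
    · refine ⟨g 1 1, fun h1 => hdet (by rw [h, h1]; ring), ?_⟩
      ext i; fin_cases i <;> simp [moebius, h, rncVec, Matrix.mulVec, dotProduct]
    · refine ⟨g 0 1, h, ?_⟩
      ext i; fin_cases i <;> simp [moebius, h, rncVec, Matrix.mulVec, dotProduct]
      field_simp
  | coe t =>
    by_cases h : g 0 0 + g 0 1 * t = 0
    · refine ⟨g 1 0 + g 1 1 * t, fun h1 => hdet ?_, ?_⟩
      · by_cases hb : g 0 1 = 0
        · have ha : g 0 0 = 0 := by simpa [hb] using h
          rw [ha, hb]; ring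
        · have : g 0 1 * (g 0 0 * g 1 1 - g 0 1 * g 1 0) = 0 := by
            linear_combination g 0 1 * g 1 1 * h - g 0 1 ^ 2 * h1
          exact (mul_eq_zero.1 this).resolve_left hb
      · ext i; fin_cases i <;> simp [moebius, h, rncVec, Matrix.mulVec, dotProduct]
    · refine ⟨g 0 0 + g 0 1 * t, h, ?_⟩
      ext i; fin_cases i <;> simp [moebius, h, rncVec, Matrix.mulVec, dotProduct]
      rw [mul_div_cancel₀ _ h]

theorem polar_moebius_eq_zero_iff (g : GL (Fin 2) F) (s : Fin 3 → F) (x y : OnePoint F) :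
    polar (symSqMatrix g.1 *ᵥ s) (rncVec 2 (moebius g x)) (rncVec 2 (moebius g y)) = 0 ↔
      polar s (rncVec 2 x) (rncVec 2 y) = 0 := by
  obtain ⟨l, hl, hx⟩ := exists_mulVec_rncVec g x
  obtain ⟨m, hm, hy⟩ := exists_mulVec_rncVec g y
  have h := polar_symSqMatrix g.1 s (rncVec 2 x) (rncVec 2 y)
  rw [hx, hy, polar_smul_smul] at h
  have hdet : g.1.det ≠ 0 := g.det.ne_zero
  constructor
  · intro h0
    rw [h0, mul_zero] at h
    exact (mul_eq_zero.1 h.symm).resolve_left (pow_ne_zero 2 hdet)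
  · intro h0
    rw [h0, mul_zero] at h
    exact (mul_eq_zero.1 h).resolve_left (mul_ne_zero hl hm)

theorem moebius_injective (g : GL (Fin 2) F) : Function.Injective (moebius g) := by
  intro x y h
  by_contra hxy
  have hb := bracket_ne_zero hxy
  -- The polar form of the conic point `x` vanishes at `(x, x)` but not at `(y, y)`.
  have h1 := polar_moebius_eq_zero_iff g (rncVec 3 x) x x
  have h2 := polar_moebius_eq_zero_iff g (rncVec 3 x) y y
  rw [h, h2] at h1
  simp [polar_rncVec, bracket_self, hb] at h1

theorem polar_point10_eq_zero_iff {e : F} (he : e ≠ 0) (x y : OnePoint F) :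
    polar ![1, 0, -e] (rncVec 2 x) (rncVec 2 y) = 0 ↔ x = divPt e y := by
  induction x using OnePoint.rec with
  | infty =>
    induction y using OnePoint.rec with
    | infty => simp [polar, rncVec, divPt]
    | coe t => by_cases ht : t = 0 <;> simp [polar, rncVec, divPt, ht]
  | coe s =>
    induction y using OnePoint.rec with
    | infty => simp [polar, rncVec, divPt]
    | coe t =>
      by_cases ht : t = 0
      · simp [polar, rncVec, divPt, ht, he]
      · simp [polar, rncVec, divPt, ht, eq_div_iff, ← sub_eq_add_neg, sub_eq_zero]

end Polar

/-! ### Points on no secant -/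

section SecantFree

variable {F : Type*} [Field F]

/-- The points of the plane on no line joining two points of the conic with parameters in `D`. A
point of the conic with parameter in `D` counts as lying on such lines. -/
def secantFree (D : Set (OnePoint F)) : Set (ℙ F (Fin 3 → F)) :=
  {P | ∀ x ∈ D, ∀ y ∈ D, x ≠ y → polar P.rep (rncVec 2 x) (rncVec 2 y) ≠ 0}

/-- The points of the conic. -/
def conic (F : Type*) [Field F] : Set (ℙ F (Fin 3 → F)) := Set.range conicPoint

theorem mk_mem_secantFree_iff {D : Set (OnePoint F)} {s : Fin 3 → F} (hs : s ≠ 0) :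
    Projectivization.mk F s hs ∈ secantFree D ↔
      ∀ x ∈ D, ∀ y ∈ D, x ≠ y → polar s (rncVec 2 x) (rncVec 2 y) ≠ 0 := by
  obtain ⟨a, ha⟩ := Projectivization.exists_smul_eq_mk_rep F s hs
  rw [secantFree, Set.mem_ofPred_eq, ← ha]
  simp only [Units.smul_def, polar_smul, mul_ne_zero_iff, ne_eq, a.ne_zero, not_false_eq_true,
    true_and]

theorem mk_mem_conic_iff {s : Fin 3 → F} (hs : s ≠ 0) :
    Projectivization.mk F s hs ∈ conic F ↔ conicForm s = 0 := by
  constructor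
  · rintro ⟨x, hx⟩
    obtain ⟨a, rfl⟩ := (Projectivization.mk_eq_mk_iff' F _ _ _ _).1 hx.symm
    rw [conicForm_smul, conicForm_rncVec, mul_zero]
  · intro h
    obtain ⟨a, x, hx⟩ := exists_eq_smul_rncVec_of_conicForm_eq_zero h
    exact ⟨x, ((Projectivization.mk_eq_mk_iff' F _ _ _ _).2 ⟨a, hx.symm⟩).symm⟩

theorem conicPoint_mem_secantFree_iff {D : Set (OnePoint F)} (hD : D.Nontrivial)
    (x : OnePoint F) : conicPoint x ∈ secantFree D ↔ x ∉ D := by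
  rw [conicPoint, mk_mem_secantFree_iff]
  simp only [polar_rncVec]
  constructor
  · intro h hx
    obtain ⟨y, hy, hyx⟩ := hD.exists_ne x
    exact h x hx y hy hyx.symm (by rw [bracket_self, zero_mul])
  · intro h y hy z hz _
    exact mul_ne_zero (bracket_ne_zero (by rintro rfl; exact h hy))
      (bracket_ne_zero (by rintro rfl; exact h hz))

theorem symSq_smul_mk (g : GL (Fin 2) F) {s : Fin 3 → F} (hs : s ≠ 0)
    (hs' : symSqMatrix g.1 *ᵥ s ≠ 0) :
    symSq g • Projectivization.mk F s hs = Projectivization.mk F (symSqMatrix g.1 *ᵥ s) hs' :=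
  rfl

theorem symSq_mulVec_ne_zero (g : GL (Fin 2) F) {s : Fin 3 → F} (hs : s ≠ 0) :
    symSqMatrix g.1 *ᵥ s ≠ 0 :=
  (smul_ne_zero_iff_ne (symSq g)).2 hs

theorem symSq_smul_mem_conic_iff (g : GL (Fin 2) F) (P : ℙ F (Fin 3 → F)) :
    symSq g • P ∈ conic F ↔ P ∈ conic F := by
  induction P using Projectivization.ind with
  | h s hs =>
    rw [symSq_smul_mk g hs (symSq_mulVec_ne_zero g hs), mk_mem_conic_iff, mk_mem_conic_iff,
      conicForm_symSqMatrix]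
    have hdet : g.1.det ≠ 0 := g.det.ne_zero
    simp [hdet]

theorem nucleus_mem_secantFree_iff (D : Set (OnePoint F)) :
    nucleus F ∈ secantFree D ↔ ∀ x ∈ D, ∀ y ∈ D, x ≠ y → x ≠ negPt y := by
  simp only [nucleus, mk_mem_secantFree_iff, ne_eq, polar_nucleus_eq_zero_iff]

variable [DecidableEq F]

theorem symSq_smul_mem_secantFree_iff (g : GL (Fin 2) F) (P : ℙ F (Fin 3 → F))
    (D : Set (OnePoint F)) :
    symSq g • P ∈ secantFree D ↔ P ∈ secantFree (moebius g⁻¹ '' D) := by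
  induction P using Projectivization.ind with
  | h s hs =>
    rw [symSq_smul_mk g hs (symSq_mulVec_ne_zero g hs), mk_mem_secantFree_iff,
      mk_mem_secantFree_iff]
    have key : ∀ x y, polar s (rncVec 2 (moebius g⁻¹ x)) (rncVec 2 (moebius g⁻¹ y)) = 0 ↔
        polar (symSqMatrix g.1 *ᵥ s) (rncVec 2 x) (rncVec 2 y) = 0 := by
      intro x y
      rw [← polar_moebius_eq_zero_iff g⁻¹ (symSqMatrix g.1 *ᵥ s) x y]
      have : symSqMatrix (g⁻¹).1 *ᵥ (symSqMatrix g.1 *ᵥ s) = s := by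
        change symSq g⁻¹ • symSq g • s = s
        rw [smul_smul, ← map_mul, inv_mul_cancel, map_one, one_smul]
      rw [this]
    simp only [Set.forall_mem_image, ne_eq, key, (moebius_injective g⁻¹).eq_iff]

theorem point10_mem_secantFree_iff {e : F} (he : e ≠ 0) (D : Set (OnePoint F)) :
    point10 (-e) ∈ secantFree D ↔ ∀ x ∈ D, ∀ y ∈ D, x ≠ y → x ≠ divPt e y := by
  simp only [point10, mk_mem_secantFree_iff, ne_eq, polar_point10_eq_zero_iff he]

theorem O2D_eq (D : Set (OnePoint F)) : O2D D = O2 F ∩ secantFree D := by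
  ext P
  constructor
  · rintro ⟨g, rfl, h⟩
    exact ⟨⟨g, rfl⟩, (symSq_smul_mem_secantFree_iff ..).2 ((nucleus_mem_secantFree_iff _).2 h)⟩
  · rintro ⟨⟨g, rfl⟩, h⟩
    exact ⟨g, rfl, (nucleus_mem_secantFree_iff _).1 ((symSq_smul_mem_secantFree_iff ..).1 h)⟩

theorem O3D_eq {ε : F} (hε : ε ≠ 0) (D : Set (OnePoint F)) :
    O3D ε D = O3 ε ∩ secantFree D := by
  ext P
  constructor
  · rintro ⟨g, rfl, h⟩
    exact ⟨⟨g, rfl⟩, (symSq_smul_mem_secantFree_iff ..).2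
      ((point10_mem_secantFree_iff hε _).2 h)⟩
  · rintro ⟨⟨g, rfl⟩, h⟩
    exact ⟨g, rfl, (point10_mem_secantFree_iff hε _).1
      ((symSq_smul_mem_secantFree_iff ..).1 h)⟩

theorem O4D_eq_O3D [CharP F 2] (D : Set (OnePoint F)) : O4D D = O3D 1 D := by
  rw [O4D, O3D, CharTwo.neg_eq]

end SecantFree

/-! ### Orbits of points off the conic -/

section Orbits

variable {F : Type*} [Field F]

theorem mk_mem_pglOrbit {s t : Fin 3 → F} (hs : s ≠ 0) (ht : t ≠ 0)
    (g : Matrix (Fin 2) (Fin 2) F) (hg : g.det ≠ 0) {l : F} (h : symSqMatrix g *ᵥ t = l • s) :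
    Projectivization.mk F s hs ∈ pglOrbit (Projectivization.mk F t ht) := by
  refine ⟨Matrix.GeneralLinearGroup.mkOfDetNeZero g hg, ?_⟩
  have h' := symSq_mulVec_ne_zero (Matrix.GeneralLinearGroup.mkOfDetNeZero g hg) ht
  change Projectivization.mk F _ h' = _
  exact (Projectivization.mk_eq_mk_iff' F _ _ _ _).2 ⟨l, h.symm⟩

theorem disjoint_O2_conic : Disjoint (O2 F) (conic F) := by
  rw [Set.disjoint_left]
  rintro _ ⟨g, rfl⟩ h
  rw [symSq_smul_mem_conic_iff, nucleus, mk_mem_conic_iff] at h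
  simp [conicForm] at h

theorem disjoint_O3_conic {ε : F} (hε : ε ≠ 0) : Disjoint (O3 ε) (conic F) := by
  rw [Set.disjoint_left]
  rintro _ ⟨g, rfl⟩ h
  rw [symSq_smul_mem_conic_iff, point10, mk_mem_conic_iff] at h
  simp [conicForm, hε] at h

/-- A point is in the orbit of `(0 : 1 : 0)` if its binary form has two rational zeros. -/
theorem mk_mem_O2 [NeZero (2 : F)] {s : Fin 3 → F} (hs : s ≠ 0) {r : F} (hr : r ≠ 0)
    (h : conicForm s = r ^ 2) : Projectivization.mk F s hs ∈ O2 F := by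
  have h2 : (2 : F) ≠ 0 := two_ne_zero
  rw [conicForm] at h
  -- The columns of the matrix are the two zeros of the binary form.
  by_cases h0 : s 0 = 0
  · have h1 : s 1 ≠ 0 := by
      intro h1
      rw [h0, h1] at h
      exact pow_ne_zero 2 hr (by rw [← h]; ring)
    refine mk_mem_pglOrbit hs _ !![0, 2 * s 1; 1, s 2] ?_ (l := 2) ?_
    · simp [Matrix.det_fin_two, h1, h2]
    · ext i
      fin_cases i <;> simp [symSqMatrix, h0]
  · refine mk_mem_pglOrbit hs _ !![s 0, s 0; s 1 + r, s 1 - r] ?_ (l := 2 * s 0) ?_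
    · have : s 0 * (s 1 - r) - s 0 * (s 1 + r) = -(2 * s 0 * r) := by ring
      simp [Matrix.det_fin_two, this, h0, h2, hr]
    · ext i
      fin_cases i <;> simp [symSqMatrix]
      · ring
      · linear_combination 2 * h

/-- The stabilizer of the conic point at infinity already moves `(1 : 0 : -ε)` to every point with
`s 0 ≠ 0` whose conic form has the same square class. -/
theorem mk_mem_O3 {s : Fin 3 → F} (hs : s ≠ 0) {ε r : F} (hr : r ≠ 0) (h0 : s 0 ≠ 0)
    (h : conicForm s = ε * r ^ 2) : Projectivization.mk F s hs ∈ O3 ε := by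
  rw [conicForm] at h
  refine mk_mem_pglOrbit hs _ !![s 0, 0; s 1, r] ?_ (l := s 0) ?_
  · simp [Matrix.det_fin_two, h0, hr]
  · ext i
    fin_cases i <;> simp [symSqMatrix]
    · ring
    · linear_combination h

variable [Fintype F]

theorem mem_conic_or_mem_O2_or_mem_O3 (hF : ringChar F ≠ 2) {ε : F} (hε : ¬IsSquare ε)
    (P : ℙ F (Fin 3 → F)) : P ∈ conic F ∨ P ∈ O2 F ∨ P ∈ O3 ε := by
  classical
  have : NeZero (2 : F) := ⟨Ring.two_ne_zero hF⟩
  induction P using Projectivization.ind with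
  | h s hs =>
    by_cases hc : conicForm s = 0
    · exact Or.inl ((mk_mem_conic_iff hs).2 hc)
    right
    by_cases hsq : IsSquare (conicForm s)
    · obtain ⟨r, hr⟩ := hsq
      refine Or.inl (mk_mem_O2 hs (r := r) ?_ (by rw [hr, sq]))
      rintro rfl
      exact hc (by simpa using hr)
    · right
      have hε0 : ε ≠ 0 := by rintro rfl; exact hε (IsSquare.zero)
      have h0 : s 0 ≠ 0 := by
        intro h0
        exact hsq ⟨s 1, by rw [conicForm, h0]; ring⟩
      -- The quotient of two nonsquares is a square.
      have hq : IsSquare (conicForm s / ε) := by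
        rw [← quadraticChar_one_iff_isSquare (div_ne_zero hc hε0), div_eq_mul_inv, map_mul,
          quadraticChar_neg_one_iff_not_isSquare.2 hsq,
          quadraticChar_neg_one_iff_not_isSquare.2 (by rwa [isSquare_inv])]
        norm_num
      obtain ⟨r, hr⟩ := hq
      have hr' : conicForm s = ε * r ^ 2 := by
        rw [sq, ← hr]; field_simp
      refine mk_mem_O3 hs ?_ h0 hr'
      rintro rfl
      exact hc (by simpa using hr')

/-- In characteristic `2` every scalar is a square, and `O₃` for `ε = 1` is the orbit of
`(1 : 0 : 1)`. -/
theorem mem_conic_or_eq_nucleus_or_mem_O3 [CharP F 2] (P : ℙ F (Fin 3 → F)) :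
    P ∈ conic F ∨ P = nucleus F ∨ P ∈ O3 (1 : F) := by
  have h2 : (2 : F) = 0 := CharTwo.two_eq_zero
  induction P using Projectivization.ind with
  | h s hs =>
    by_cases hc : conicForm s = 0
    · exact Or.inl ((mk_mem_conic_iff hs).2 hc)
    right
    obtain ⟨r, hr⟩ := FiniteField.isSquare_of_char_two (ringChar.eq F 2) (conicForm s)
    by_cases h0 : s 0 = 0
    · by_cases hs2 : s 2 = 0
      · left
        refine (Projectivization.mk_eq_mk_iff' F _ _ _ _).2 ⟨s 1, ?_⟩
        ext i; fin_cases i <;> simp [h0, hs2]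
      · right
        have h1 : s 1 ≠ 0 := by
          intro h1; exact hc (by rw [conicForm, h0, h1]; ring)
        refine mk_mem_pglOrbit hs _ !![s 1, s 1; s 2, 0] ?_ (l := s 2) ?_
        · simp [Matrix.det_fin_two, h1, hs2]
        · ext i
          fin_cases i <;> simp [symSqMatrix, h0]
          · ring
          · ring
    · right
      refine mk_mem_O3 hs (r := r) ?_ h0 (by rw [hr]; ring)
      rintro rfl
      exact hc (by simpa using hr)

end Orbits

/-! ### Counting with the involutions of the line -/

section Counting

theorem card_onePoint {α : Type*} [Fintype α] :
    Fintype.card (OnePoint α) = Fintype.card α + 1 :=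
  Fintype.card_option

/-- A set containing no two distinct elements one of which is the image of the other under `σ` is
disjoint from its image outside the fixed points of `σ`. -/
theorem two_mul_card_le {α : Type*} [Fintype α] [DecidableEq α] {σ : α → α}
    (hσ : Function.Injective σ) {S T : Finset α} (hT : ∀ x, σ x = x → x ∈ T)
    (hS : ∀ x ∈ S, ∀ y ∈ S, x ≠ y → x ≠ σ y) :
    2 * S.card ≤ Fintype.card α + T.card := by
  have h1 := Finset.card_union_add_card_inter S (S.image σ)
  rw [Finset.card_image_of_injective S hσ] at h1
  have h2 : (S ∪ S.image σ).card ≤ Fintype.card α := Finset.card_le_univ _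
  have h3 : (S ∩ S.image σ).card ≤ T.card := by
    refine Finset.card_le_card fun x hx => ?_
    rw [Finset.mem_inter, Finset.mem_image] at hx
    obtain ⟨hx, y, hy, rfl⟩ := hx
    by_cases h : σ y = y
    · rw [h]; exact hT y h
    · exact absurd rfl (hS _ hx y hy h)
  omega

variable {F : Type*} [Field F]

theorem negPt_injective : Function.Injective (negPt : OnePoint F → OnePoint F) :=
  Option.map_injective neg_injective

theorem eq_zero_or_eq_infty_of_negPt_eq (h2 : (2 : F) ≠ 0) {x : OnePoint F} (h : negPt x = x) :
    x = ((0 : F) : OnePoint F) ∨ x = ∞ := by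
  induction x using OnePoint.rec with
  | infty => simp
  | coe t =>
    have h : -t = t := by simpa [negPt] using h
    have : 2 * t = 0 := by linear_combination -h
    simpa [h2] using this

variable [DecidableEq F]

theorem divPt_injective {e : F} (he : e ≠ 0) : Function.Injective (divPt e) := by
  -- The polar form of `(1 : 0 : -e)` is symmetric, so `divPt e` is an involution.
  have : Function.Involutive (divPt e) := by
    intro x
    symm
    rw [← polar_point10_eq_zero_iff he]
    rw [polar_comm]
    exact (polar_point10_eq_zero_iff he (divPt e x) x).2 rfl
  exact this.injective

theorem mul_self_eq_of_divPt_eq {e : F} (he : e ≠ 0) {x : OnePoint F} (h : divPt e x = x) :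
    ∃ t : F, x = t ∧ t * t = e := by
  have h' := (polar_point10_eq_zero_iff he x x).2 h.symm
  induction x using OnePoint.rec with
  | infty => simp [polar, rncVec] at h'
  | coe t => exact ⟨t, rfl, by simp [polar, rncVec] at h'; linear_combination h'⟩

variable [Fintype F] {n : ℕ} {D : Fin n → OnePoint F}

theorem two_mul_le_of_moebius_image (hD : Function.Injective D) (g : GL (Fin 2) F)
    {σ : OnePoint F → OnePoint F} (hσ : Function.Injective σ) {T : Finset (OnePoint F)}
    (hT : ∀ x, σ x = x → x ∈ T)
    (h : ∀ x ∈ moebius g '' Set.range D, ∀ y ∈ moebius g '' Set.range D, x ≠ y → x ≠ σ y) :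
    2 * n ≤ Fintype.card F + 1 + T.card := by
  classical
  have hc := two_mul_card_le (S := Finset.univ.image (moebius g ∘ D)) hσ hT (by
    simpa [Set.forall_mem_image] using h)
  rwa [Finset.card_image_of_injective _ ((moebius_injective g).comp hD), Finset.card_univ,
    Fintype.card_fin, card_onePoint] at hc

/-- The involution `x ↦ -x` has the fixed points `0` and `∞`, which bounds the size of a set
joined by no line through a point of `O₂`. -/
theorem O2D_eq_empty (h2 : (2 : F) ≠ 0) (hD : Function.Injective D)
    (hn : Fintype.card F + 3 < 2 * n) : O2D (Set.range D) = ∅ := by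
  rw [Set.eq_empty_iff_forall_notMem]
  rintro _ ⟨g, rfl, h⟩
  classical
  have h1 := two_mul_le_of_moebius_image (T := {((0 : F) : OnePoint F), ∞}) hD g⁻¹
    negPt_injective (fun x hx => by simpa using eq_zero_or_eq_infty_of_negPt_eq h2 hx) h
  have h3 := Finset.card_le_two (a := ((0 : F) : OnePoint F)) (b := ∞)
  omega

/-- The involution `x ↦ ε / x` has no fixed point for `ε` a nonsquare. -/
theorem O3D_eq_empty {ε : F} (hε : ¬IsSquare ε) (hD : Function.Injective D)
    (hn : Fintype.card F + 1 < 2 * n) : O3D ε (Set.range D) = ∅ := by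
  have hε0 : ε ≠ 0 := by rintro rfl; exact hε (IsSquare.zero)
  rw [Set.eq_empty_iff_forall_notMem]
  rintro _ ⟨g, rfl, h⟩
  have h1 := two_mul_le_of_moebius_image (T := ∅) hD g⁻¹ (divPt_injective hε0) (fun x hx => by
    obtain ⟨t, -, ht⟩ := mul_self_eq_of_divPt_eq hε0 hx
    exact absurd ⟨t, ht.symm⟩ hε) h
  simp at h1
  omega

/-- In characteristic `2` the involution `x ↦ 1 / x` has the single fixed point `1`. -/
theorem O3D_one_eq_empty [CharP F 2] (hD : Function.Injective D)
    (hn : Fintype.card F + 2 < 2 * n) : O3D (1 : F) (Set.range D) = ∅ := by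
  rw [Set.eq_empty_iff_forall_notMem]
  rintro _ ⟨g, rfl, h⟩
  have h1 := two_mul_le_of_moebius_image (T := {((1 : F) : OnePoint F)}) hD g⁻¹
    (divPt_injective one_ne_zero) (fun x hx => by
      obtain ⟨t, rfl, ht⟩ := mul_self_eq_of_divPt_eq one_ne_zero hx
      rw [← sq, ← one_pow 2, CharTwo.sq_inj] at ht
      simp [ht]) h
  simp at h1
  omega

end Counting

/-! ### Decomposition of the set of points on no secant -/

section Decomposition

variable {F : Type*} [Field F]

theorem conic_inter_secantFree {D : Set (OnePoint F)} (hD : D.Nontrivial) :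
    conic F ∩ secantFree D = {P | ∃ δ : OnePoint F, δ ∉ D ∧ P = conicPoint δ} := by
  ext P
  constructor
  · rintro ⟨⟨x, rfl⟩, h⟩
    exact ⟨x, (conicPoint_mem_secantFree_iff hD x).1 h, rfl⟩
  · rintro ⟨x, hx, rfl⟩
    exact ⟨⟨x, rfl⟩, (conicPoint_mem_secantFree_iff hD x).2 hx⟩

theorem nucleus_mem_secantFree [CharP F 2] (D : Set (OnePoint F)) : nucleus F ∈ secantFree D := by
  rw [nucleus_mem_secantFree_iff]
  intro x _ y _ hxy
  have : negPt y = y := by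
    induction y using OnePoint.rec <;> simp [negPt, CharTwo.neg_eq]
  rwa [this]

variable [Fintype F] [DecidableEq F]

theorem secantFree_eq_of_odd (hF : ringChar F ≠ 2) {ε : F} (hε : ¬IsSquare ε)
    {D : Set (OnePoint F)} (hD : D.Nontrivial) :
    secantFree D = O1D D ∪ O2D D ∪ O3D ε D := by
  have hε0 : ε ≠ 0 := by rintro rfl; exact hε (IsSquare.zero)
  have hodd : ¬Even (Fintype.card F) := by
    rw [Nat.even_iff, FiniteField.odd_card_of_char_ne_two hF]; simp
  have h1 : O1D D = conic F ∩ secantFree D := by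
    rw [conic_inter_secantFree hD]; simp [O1D, hodd]
  rw [h1, O2D_eq, O3D_eq hε0, ← Set.union_inter_distrib_right, ← Set.union_inter_distrib_right,
    eq_comm, Set.inter_eq_right]
  intro P _
  rw [Set.union_assoc]
  exact mem_conic_or_mem_O2_or_mem_O3 hF hε P

/-- The part `O₃(D)` with `ε = 1` is `O₄(D)` here, see `O4D_eq_O3D`. -/
theorem secantFree_eq_of_even [CharP F 2] {D : Set (OnePoint F)} (hD : D.Nontrivial) :
    secantFree D = O1D D ∪ O3D 1 D := by
  have heven : Even (Fintype.card F) :=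
    Nat.even_iff.2 (FiniteField.even_card_iff_char_two.1 (ringChar.eq F 2))
  have h1 : O1D D = (conic F ∪ {nucleus F}) ∩ secantFree D := by
    rw [Set.union_inter_distrib_right, conic_inter_secantFree hD,
      Set.inter_eq_left.2 (Set.singleton_subset_iff.2 (nucleus_mem_secantFree D))]
    simp [O1D, heven, Set.ext_iff, or_comm]
  rw [h1, O3D_eq one_ne_zero, ← Set.union_inter_distrib_right, eq_comm, Set.inter_eq_right]
  intro P _
  rw [Set.union_assoc]
  exact mem_conic_or_eq_nucleus_or_mem_O3 P

end Decomposition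

/-! ### Parity check matrices of Reed–Solomon codes -/

section ParityCheck

variable {F : Type*} [Field F] {n : ℕ} {D : Fin n → OnePoint F}

theorem colMul_ne_zero (hD : Function.Injective D) (j : Fin n) : colMul D j ≠ 0 :=
  Finset.prod_ne_zero_iff.2 fun _ hi =>
    inv_ne_zero (bracket_ne_zero (hD.ne (Finset.ne_of_mem_erase hi)))

theorem syndrome_eq_sum (r : ℕ) (D : Fin n → OnePoint F) (u : Fin n → F) :
    syndrome r D u = ∑ j, (u j * colMul D j) • rncVec r (D j) := by
  ext a
  simp only [syndrome, Matrix.mulVec, dotProduct, parityCheck, Matrix.of_apply, Finset.sum_apply,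
    Pi.smul_apply, smul_eq_mul]
  exact Finset.sum_congr rfl fun j _ => by ring

/-- The parity checks hold on the code: each is, up to sign, a coefficient of a polynomial `X ^ a f`
computed by Lagrange interpolation at the finite evaluation points. -/
theorem sum_colMul_mul_eq_zero {k : ℕ} {D : Fin (k + 3) → OnePoint F}
    (hD : Function.Injective D) {f : Polynomial F} (hf : f.degree < k) (a : Fin 3) :
    ∑ j, colMul D j * rncVec 3 (D j) a * evalAt k f (D j) = 0 := by
  have hdeg : (Polynomial.X ^ (a : ℕ) * f).degree < ((k + 2 : ℕ) : WithBot ℕ) := by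
    by_cases hf0 : f = 0
    · rw [hf0, mul_zero, Polynomial.degree_zero]
      exact WithBot.bot_lt_coe _
    · have ha := a.isLt
      rw [← Polynomial.natDegree_lt_iff_degree_lt hf0] at hf
      rw [← Polynomial.natDegree_lt_iff_degree_lt (by simp [hf0]),
        Polynomial.natDegree_mul (by simp) hf0, Polynomial.natDegree_X_pow]
      omega
  set x : Fin (k + 3) → F := fun j => (D j).elim 0 id with hx
  have hfin : ∀ j, D j ≠ ∞ → D j = (x j : OnePoint F) := by
    intro j hj
    obtain ⟨t, ht⟩ := OnePoint.ne_infty_iff_exists.1 hj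
    simp [hx, ← ht]
  by_cases h : ∃ j₀, D j₀ = ∞
  · obtain ⟨j₀, hj₀⟩ := h
    have hne : ∀ j ∈ Finset.univ.erase j₀, D j = (x j : OnePoint F) := fun j hj =>
      hfin j fun h' => Finset.ne_of_mem_erase hj (hD (h'.trans hj₀.symm))
    have hinj : Set.InjOn x (Finset.univ.erase j₀ : Finset (Fin (k + 3))) := by
      intro i hi j hj hij
      exact hD (by rw [hne i hi, hne j hj, hij])
    have hcard : (Finset.univ.erase j₀ : Finset (Fin (k + 3))).card = k + 2 := by
      rw [Finset.card_erase_of_mem (Finset.mem_univ _), Finset.card_univ, Fintype.card_fin]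
      rfl
    have hsum := Lagrange.coeff_eq_sum hinj (P := Polynomial.X ^ (a : ℕ) * f)
      (by rwa [hcard])
    have h1 : colMul D j₀ = 1 := by
      refine Finset.prod_eq_one fun i hi => ?_
      rw [hne i hi, hj₀, bracket_coe_infty, inv_one]
    have h2 : ∀ j ∈ Finset.univ.erase j₀, colMul D j * rncVec 3 (D j) a * evalAt k f (D j) =
        -((Polynomial.X ^ (a : ℕ) * f).eval (x j) /
          ∏ i ∈ (Finset.univ.erase j₀).erase j, (x j - x i)) := by
      intro j hj
      have hj' : j₀ ∈ Finset.univ.erase j := by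
        simpa using (Finset.ne_of_mem_erase hj).symm
      have hmul : colMul D j = -(∏ i ∈ (Finset.univ.erase j₀).erase j, (x j - x i))⁻¹ := by
        rw [colMul, ← Finset.mul_prod_erase _ _ hj', Finset.erase_right_comm, hne j hj, hj₀,
          bracket_infty_coe, ← Finset.prod_inv_distrib, inv_neg, inv_one, neg_one_mul]
        congr 1
        refine Finset.prod_congr rfl fun i hi => ?_
        rw [hne i (Finset.mem_of_mem_erase hi), bracket_coe_coe]
      rw [hmul, hne j hj]
      simp [rncVec, evalAt]
      ring
    rw [← Finset.add_sum_erase _ _ (Finset.mem_univ j₀), Finset.sum_congr rfl h2,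
      Finset.sum_neg_distrib, ← hsum, h1, hcard, hj₀]
    fin_cases a
    · have hf' : f.degree < ((k + 1 : ℕ) : WithBot ℕ) :=
        hf.trans (by exact_mod_cast Nat.lt_succ_self k)
      simp [rncVec, Polynomial.coeff_eq_zero_of_degree_lt hf']
    · simp [rncVec, Polynomial.coeff_eq_zero_of_degree_lt hf]
    · cases k with
      | zero =>
        have : f = 0 := Polynomial.degree_eq_bot.1 (by simpa using hf)
        simp [rncVec, evalAt, this]
      | succ m => simp [rncVec, evalAt, Polynomial.coeff_X_pow_mul f 2 m]
  · push Not at h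
    have hne : ∀ j, D j = (x j : OnePoint F) := fun j => hfin j (h j)
    have hinj : Set.InjOn x (Finset.univ : Finset (Fin (k + 3))) := by
      intro i _ j _ hij
      exact hD (by rw [hne i, hne j, hij])
    have hsum := Lagrange.coeff_eq_sum hinj (P := Polynomial.X ^ (a : ℕ) * f)
      (by
        rw [Finset.card_univ, Fintype.card_fin]
        exact hdeg.trans (by exact_mod_cast Nat.lt_succ_self _))
    rw [Finset.card_univ, Fintype.card_fin, Nat.add_sub_assoc (by norm_num),
      Polynomial.coeff_eq_zero_of_degree_lt hdeg] at hsum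
    rw [hsum]
    refine Finset.sum_congr rfl fun j _ => ?_
    have hmul : colMul D j = (∏ i ∈ Finset.univ.erase j, (x j - x i))⁻¹ := by
      rw [colMul, ← Finset.prod_inv_distrib]
      refine Finset.prod_congr rfl fun i _ => ?_
      rw [hne i, hne j, bracket_coe_coe]
    rw [hmul, hne j]
    simp [rncVec, evalAt]
    ring

theorem syndrome_eq_zero_of_mem_rsCode {k : ℕ} {D : Fin (k + 3) → OnePoint F}
    (hD : Function.Injective D) {w : Fin (k + 3) → F} (hw : w ∈ rsCode k D) :
    syndrome 3 D w = 0 := by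
  obtain ⟨f, hf, h⟩ := hw
  ext a
  simp only [syndrome, Matrix.mulVec, dotProduct, parityCheck, Matrix.of_apply, h]
  exact sum_colMul_mul_eq_zero hD hf a

/-- Every linear combination of columns of the parity check matrix is the syndrome of a word
supported on these columns. -/
theorem exists_syndrome_eq_sum (r : ℕ) (hD : Function.Injective D) (T : Finset (Fin n))
    (a : Fin n → F) :
    ∃ w : Fin n → F, (∀ j ∉ T, w j = 0) ∧ syndrome r D w = ∑ j ∈ T, a j • rncVec r (D j) := by
  refine ⟨fun j => if j ∈ T then a j / colMul D j else 0, fun j hj => if_neg hj, ?_⟩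
  rw [syndrome_eq_sum, ← Finset.sum_filter_add_sum_filter_not Finset.univ (· ∈ T),
    Finset.filter_univ_mem, Finset.sum_eq_zero (s := Finset.univ.filter fun j => j ∉ T), add_zero]
  · refine Finset.sum_congr rfl fun j hj => ?_
    rw [if_pos hj, div_mul_cancel₀ _ (colMul_ne_zero hD j)]
  · intro j hj
    rw [if_neg (Finset.mem_filter.1 hj).2, zero_mul, zero_smul]

/-- Every vector is a combination of at most three columns. -/
theorem exists_eq_sum_of_card_le_three {k : ℕ} {D : Fin (k + 3) → OnePoint F}
    (hD : Function.Injective D) (s : Fin 3 → F) :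
    ∃ (T : Finset (Fin (k + 3))) (a : Fin (k + 3) → F), T.card ≤ 3 ∧
      s = ∑ j ∈ T, a j • rncVec 3 (D j) := by
  have h01 : (⟨0, by omega⟩ : Fin (k + 3)) ≠ ⟨1, by omega⟩ := by simp
  have h02 : (⟨0, by omega⟩ : Fin (k + 3)) ≠ ⟨2, by omega⟩ := by simp
  have h12 : (⟨1, by omega⟩ : Fin (k + 3)) ≠ ⟨2, by omega⟩ := by simp
  obtain ⟨a, b, c, h⟩ := exists_eq_add_add (hD.ne h01) (hD.ne h02) (hD.ne h12) s
  refine ⟨{⟨0, by omega⟩, ⟨1, by omega⟩, ⟨2, by omega⟩},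
    fun j => if j = ⟨0, by omega⟩ then a else if j = ⟨1, by omega⟩ then b else c,
    Finset.card_le_three, ?_⟩
  rw [Finset.sum_insert (by simp), Finset.sum_pair h12, h, add_assoc]
  simp

theorem exists_syndrome_eq {k : ℕ} {D : Fin (k + 3) → OnePoint F}
    (hD : Function.Injective D) (s : Fin 3 → F) : ∃ u, syndrome 3 D u = s := by
  obtain ⟨T, a, -, h⟩ := exists_eq_sum_of_card_le_three hD s
  obtain ⟨w, -, hw⟩ := exists_syndrome_eq_sum 3 hD T a
  exact ⟨w, hw.trans h.symm⟩

theorem exists_syndrome_mk_eq {k : ℕ} {D : Fin (k + 3) → OnePoint F}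
    (hD : Function.Injective D) (P : ℙ F (Fin 3 → F)) :
    ∃ u, ∃ h : syndrome 3 D u ≠ 0, P = Projectivization.mk F (syndrome 3 D u) h := by
  obtain ⟨u, hu⟩ := exists_syndrome_eq hD P.rep
  refine ⟨u, by rw [hu]; exact P.rep_nonzero, ?_⟩
  simp only [hu, Projectivization.mk_rep]

/-- The encoding map of the Reed–Solomon code. -/
noncomputable def encode (k : ℕ) (D : Fin n → OnePoint F) :
    Polynomial.degreeLT F k →ₗ[F] (Fin n → F) where
  toFun f i := evalAt k f.1 (D i)
  map_add' f g := by
    ext i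
    simp only [Pi.add_apply]
    generalize D i = x
    cases x using OnePoint.rec <;> simp [evalAt]
  map_smul' c f := by
    ext i
    simp only [Pi.smul_apply, RingHom.id_apply]
    generalize D i = x
    cases x using OnePoint.rec <;> simp [evalAt]

theorem mem_range_encode_iff (k : ℕ) (D : Fin n → OnePoint F) (w : Fin n → F) :
    w ∈ LinearMap.range (encode k D) ↔ w ∈ rsCode k D := by
  constructor
  · rintro ⟨f, rfl⟩
    exact ⟨f.1, Polynomial.mem_degreeLT.1 f.2, fun _ => rfl⟩
  · rintro ⟨f, hf, h⟩
    exact ⟨⟨f, Polynomial.mem_degreeLT.2 hf⟩, funext fun i => (h i).symm⟩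

theorem encode_injective {k : ℕ} (hD : Function.Injective D) (hn : k < n) :
    Function.Injective (encode k D) := by
  classical
  rw [← LinearMap.ker_eq_bot, LinearMap.ker_eq_bot']
  rintro ⟨f, hf⟩ h
  have hz : ∀ i, evalAt k f (D i) = 0 := fun i => congrFun h i
  rw [Polynomial.mem_degreeLT] at hf
  set s := Finset.univ.filter fun i => D i ≠ ∞ with hs
  have hfin : ∀ j ∈ s, D j = (((D j).elim 0 id : F) : OnePoint F) := by
    intro j hj
    obtain ⟨t, ht⟩ := OnePoint.ne_infty_iff_exists.1 (Finset.mem_filter.1 hj).2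
    simp [← ht]
  have hcard : k ≤ s.card := by
    have h1 : (Finset.univ.filter fun i => D i = ∞).card ≤ 1 :=
      Finset.card_le_one.2 fun i hi j hj => hD (by
        rw [(Finset.mem_filter.1 hi).2, (Finset.mem_filter.1 hj).2])
    have h2 := Finset.card_filter_add_card_filter_not (s := (Finset.univ : Finset (Fin n)))
      (fun i => D i = ∞)
    rw [Finset.card_univ, Fintype.card_fin] at h2
    change _ + s.card = n at h2
    omega
  have hf0 : f = 0 := by
    refine Polynomial.eq_zero_of_degree_lt_of_eval_index_eq_zero (s := s)
      (v := fun j => ((D j).elim 0 id : F)) ?_ (hf.trans_le (Nat.cast_le.2 hcard)) ?_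
    · intro i hi j hj hij
      refine hD ?_
      rw [hfin i hi, hfin j hj]
      exact congrArg _ hij
    · intro j hj
      have := hz j
      rw [hfin j hj] at this
      exact this
  exact Subtype.ext hf0

/-- The code is the kernel of the parity check matrix, by comparison of dimensions. -/
theorem mem_rsCode_iff_syndrome_eq_zero {k : ℕ} {D : Fin (k + 3) → OnePoint F}
    (hD : Function.Injective D) (w : Fin (k + 3) → F) :
    w ∈ rsCode k D ↔ syndrome 3 D w = 0 := by
  have hle : LinearMap.range (encode k D) ≤ LinearMap.ker (parityCheck 3 D).mulVecLin := by
    intro w hw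
    exact syndrome_eq_zero_of_mem_rsCode hD ((mem_range_encode_iff k D w).1 hw)
  have h1 : Module.finrank F (LinearMap.range (encode k D)) = k := by
    rw [LinearMap.finrank_range_of_inj (encode_injective hD (by omega)),
      (Polynomial.degreeLTEquiv F k).finrank_eq, Module.finrank_fin_fun]
  have h2 := LinearMap.finrank_range_add_finrank_ker (parityCheck 3 D).mulVecLin
  have htop : LinearMap.range (parityCheck 3 D).mulVecLin = ⊤ :=
    LinearMap.range_eq_top.2 fun s => exists_syndrome_eq hD s
  rw [htop, finrank_top, Module.finrank_fin_fun, Module.finrank_fin_fun] at h2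
  rw [← mem_range_encode_iff, Submodule.eq_of_le_of_finrank_le hle (by omega)]
  rfl

end ParityCheck

/-! ### Distance to the code in terms of syndromes -/

section Distance

theorem coveringRadius_eq {F : Type*} [DecidableEq F] {n : ℕ} {C : Set (Fin n → F)} {r : ℕ}
    (hle : ∀ u, distToCode C u ≤ r) {u : Fin n → F} (hu : distToCode C u = r) :
    coveringRadius C = r :=
  IsGreatest.csSup_eq ⟨⟨u, hu⟩, by rintro _ ⟨v, rfl⟩; exact hle v⟩

variable {F : Type*} [Field F] [DecidableEq F] {k : ℕ} {D : Fin (k + 3) → OnePoint F}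

theorem distToCode_le_iff (hD : Function.Injective D) (u : Fin (k + 3) → F) (m : ℕ) :
    distToCode (rsCode k D) u ≤ m ↔
      ∃ (T : Finset (Fin (k + 3))) (a : Fin (k + 3) → F), T.card ≤ m ∧
        syndrome 3 D u = ∑ j ∈ T, a j • rncVec 3 (D j) := by
  have hsub : ∀ v w : Fin (k + 3) → F,
      syndrome 3 D (v - w) = syndrome 3 D v - syndrome 3 D w := Matrix.mulVec_sub _
  constructor
  · intro h
    have hne : ((fun c => hammingDist u c) '' rsCode k D).Nonempty :=
      Set.Nonempty.image _ ⟨0, (mem_rsCode_iff_syndrome_eq_zero hD 0).2 (Matrix.mulVec_zero _)⟩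
    obtain ⟨c, hc, hcu⟩ := Nat.sInf_mem hne
    refine ⟨Finset.univ.filter fun j => u j ≠ c j, fun j => (u - c) j * colMul D j, ?_, ?_⟩
    · exact (le_of_eq hcu).trans h
    · have : syndrome 3 D u = syndrome 3 D (u - c) := by
        rw [hsub, (mem_rsCode_iff_syndrome_eq_zero hD c).1 hc, sub_zero]
      rw [this, syndrome_eq_sum, eq_comm]
      refine Finset.sum_subset (Finset.subset_univ _) fun j _ hj => ?_
      have : u j = c j := by simpa using hj
      simp [this]
  · rintro ⟨T, a, hT, h⟩
    obtain ⟨w, hw, hs⟩ := exists_syndrome_eq_sum 3 hD T a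
    have hmem : u - w ∈ rsCode k D := by
      rw [mem_rsCode_iff_syndrome_eq_zero hD, hsub, hs, h, sub_self]
    have hle : distToCode (rsCode k D) u ≤ hammingDist u (u - w) :=
      Nat.sInf_le ⟨u - w, hmem, rfl⟩
    refine hle.trans (le_trans (Finset.card_le_card ?_) hT)
    intro j hj
    by_contra hjT
    simp [hw j hjT] at hj

theorem distToCode_le_three (hD : Function.Injective D) (u : Fin (k + 3) → F) :
    distToCode (rsCode k D) u ≤ 3 := by
  obtain ⟨T, a, hT, h⟩ := exists_eq_sum_of_card_le_three hD (syndrome 3 D u)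
  exact (distToCode_le_iff hD u 3).2 ⟨T, a, hT, h⟩

theorem distToCode_le_two_iff (hD : Function.Injective D) (u : Fin (k + 3) → F) :
    distToCode (rsCode k D) u ≤ 2 ↔
      ∃ i j, i ≠ j ∧ polar (syndrome 3 D u) (rncVec 2 (D i)) (rncVec 2 (D j)) = 0 := by
  rw [distToCode_le_iff hD]
  constructor
  · rintro ⟨T, a, hT, h⟩
    obtain ⟨U, hTU, hU⟩ := Finset.exists_superset_card_eq hT (by simp)
    obtain ⟨i, j, hij, rfl⟩ := Finset.card_eq_two.1 hU
    refine ⟨i, j, hij, ?_⟩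
    have hsum : syndrome 3 D u = ∑ l ∈ {i, j}, (if l ∈ T then a l else 0) • rncVec 3 (D l) := by
      rw [h, ← Finset.sum_subset hTU (fun l _ hl => by simp [hl])]
      exact Finset.sum_congr rfl fun l hl => by rw [if_pos hl]
    rw [hsum, Finset.sum_pair hij, polar_add, polar_smul, polar_smul, polar_rncVec, polar_rncVec,
      bracket_self, bracket_self]
    ring
  · rintro ⟨i, j, hij, h⟩
    obtain ⟨a, b, hab⟩ := exists_eq_add_of_polar_eq_zero (hD.ne hij) h
    refine ⟨{i, j}, fun l => if l = i then a else b, Finset.card_le_two, ?_⟩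
    rw [Finset.sum_pair hij, hab]
    simp [hij.symm]

theorem conicForm_eq_zero_of_distToCode_le_one (hD : Function.Injective D) {u : Fin (k + 3) → F}
    (h : distToCode (rsCode k D) u ≤ 1) : conicForm (syndrome 3 D u) = 0 := by
  obtain ⟨T, a, hT, h⟩ := (distToCode_le_iff hD u 1).1 h
  rw [h]
  rcases Nat.le_one_iff_eq_zero_or_eq_one.1 hT with h0 | h1
  · rw [Finset.card_eq_zero.1 h0]; simp [conicForm]
  · obtain ⟨i, rfl⟩ := Finset.card_eq_one.1 h1
    rw [Finset.sum_singleton, conicForm_smul, conicForm_rncVec, mul_zero]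

theorem distToCode_le_one_iff_of_surjective (hD : Function.Bijective D) (u : Fin (k + 3) → F) :
    distToCode (rsCode k D) u ≤ 1 ↔ conicForm (syndrome 3 D u) = 0 := by
  refine ⟨conicForm_eq_zero_of_distToCode_le_one hD.1, fun h => ?_⟩
  obtain ⟨a, x, hx⟩ := exists_eq_smul_rncVec_of_conicForm_eq_zero h
  obtain ⟨i, rfl⟩ := hD.2 x
  exact (distToCode_le_iff hD.1 u 1).2 ⟨{i}, fun _ => a, by simp, by simpa using hx⟩

end Distance

/-! ### Deep holes -/

section DeepHoles

variable {F : Type*} [Field F] [DecidableEq F] {k : ℕ} {D : Fin (k + 3) → OnePoint F}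

theorem distToCode_eq_three_iff (hD : Function.Injective D) (u : Fin (k + 3) → F)
    (hu : syndrome 3 D u ≠ 0) :
    distToCode (rsCode k D) u = 3 ↔
      Projectivization.mk F (syndrome 3 D u) hu ∈ secantFree (Set.range D) := by
  have h3 := distToCode_le_three hD u
  have : distToCode (rsCode k D) u = 3 ↔ ¬ distToCode (rsCode k D) u ≤ 2 := by omega
  rw [this, distToCode_le_two_iff hD, mk_mem_secantFree_iff]
  push Not
  simp only [Set.forall_mem_range, hD.ne_iff]

/-- If some point is on no secant, the covering radius is `3`. -/
theorem coveringRadius_eq_three (hD : Function.Injective D)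
    (h : (secantFree (Set.range D)).Nonempty) : coveringRadius (rsCode k D) = 3 := by
  obtain ⟨P, hP⟩ := h
  obtain ⟨u, hu, rfl⟩ := exists_syndrome_mk_eq hD P
  exact coveringRadius_eq (distToCode_le_three hD) ((distToCode_eq_three_iff hD u hu).2 hP)

/-- If every point is on a secant, the covering radius is `2`: it is not smaller, because
`(0 : 1 : 0)` is not on the conic. -/
theorem coveringRadius_eq_two (hD : Function.Injective D)
    (h : secantFree (Set.range D) = ∅) : coveringRadius (rsCode k D) = 2 := by
  have hle : ∀ u, distToCode (rsCode k D) u ≤ 2 := by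
    intro u
    by_cases hu : syndrome 3 D u = 0
    · exact ((distToCode_le_iff hD u 0).2 ⟨∅, 0, by simp, by simpa using hu⟩).trans (by simp)
    · have h3 := distToCode_le_three hD u
      have := (distToCode_eq_three_iff hD u hu).not.2 (by simp [h])
      omega
  obtain ⟨u, hu⟩ := exists_syndrome_eq hD ![0, 1, 0]
  refine coveringRadius_eq hle (u := u) (le_antisymm (hle u) ?_)
  by_contra hlt
  have := conicForm_eq_zero_of_distToCode_le_one hD (u := u) (by omega)
  rw [hu] at this
  simp [conicForm] at this

theorem syndrome_ne_zero_of_isDeepHole (hD : Function.Injective D) {u : Fin (k + 3) → F}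
    (hu : IsDeepHole (rsCode k D) u) : syndrome 3 D u ≠ 0 := by
  intro h0
  have h := (distToCode_le_iff hD u 0).2 ⟨∅, 0, by simp, by simpa using h0⟩
  rw [hu] at h
  rcases (secantFree (Set.range D)).eq_empty_or_nonempty with he | hne
  · rw [coveringRadius_eq_two hD he] at h; omega
  · rw [coveringRadius_eq_three hD hne] at h; omega

theorem deepHoleSyndromes_eq_secantFree (hD : Function.Injective D)
    (h : (secantFree (Set.range D)).Nonempty) :
    deepHoleSyndromes 3 k D = secantFree (Set.range D) := by
  ext P
  constructor
  · rintro ⟨u, hu, hs, rfl⟩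
    rw [IsDeepHole, coveringRadius_eq_three hD h] at hu
    exact (distToCode_eq_three_iff hD u hs).1 hu
  · intro hP
    obtain ⟨u, hs, rfl⟩ := exists_syndrome_mk_eq hD P
    refine ⟨u, ?_, hs, rfl⟩
    rw [IsDeepHole, coveringRadius_eq_three hD h]
    exact (distToCode_eq_three_iff hD u hs).2 hP

theorem deepHoleSyndromes_eq_compl_conic (hD : Function.Bijective D)
    (h : secantFree (Set.range D) = ∅) : deepHoleSyndromes 3 k D = (conic F)ᶜ := by
  have h2 := coveringRadius_eq_two hD.1 h
  have key : ∀ u, IsDeepHole (rsCode k D) u ↔ conicForm (syndrome 3 D u) ≠ 0 := by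
    intro u
    have hle : distToCode (rsCode k D) u ≤ 2 := by
      rw [← h2]
      exact le_csSup ⟨3, by rintro _ ⟨v, rfl⟩; exact distToCode_le_three hD.1 v⟩ ⟨u, rfl⟩
    rw [ne_eq, ← distToCode_le_one_iff_of_surjective hD, IsDeepHole, h2]
    omega
  ext P
  rw [Set.mem_compl_iff]
  constructor
  · rintro ⟨u, hu, hs, rfl⟩
    rwa [mk_mem_conic_iff, ← ne_eq, ← key]
  · intro hP
    obtain ⟨u, hs, rfl⟩ := exists_syndrome_mk_eq hD.1 P
    rw [mk_mem_conic_iff, ← ne_eq, ← key] at hP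
    exact ⟨u, hP, hs, rfl⟩

end DeepHoles

/-! ### Determination of the deep holes -/

section Determination

theorem range_nontrivial {α : Type*} {k : ℕ} {D : Fin (k + 3) → OnePoint α}
    (hD : Function.Injective D) : (Set.range D).Nontrivial :=
  have : Nontrivial (Fin (k + 3)) := Fin.nontrivial_iff_two_le.2 (by omega)
  Set.image_univ (f := D) ▸ Set.nontrivial_univ.image hD

theorem bijective_of_add_two_eq {α : Type*} [Fintype α] {k : ℕ} {D : Fin (k + 3) → OnePoint α}
    (hD : Function.Injective D)
    (h : k + 2 = Fintype.card α) :
    Function.Bijective D := by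
  rw [Fintype.bijective_iff_injective_and_card, Fintype.card_fin, card_onePoint]
  exact ⟨hD, by omega⟩

variable {F : Type*} [Field F] [Fintype F] {k : ℕ} {D : Fin (k + 3) → OnePoint F}

theorem secantFree_nonempty_of_add_three_le (hD : Function.Injective D)
    (h : k + 3 ≤ Fintype.card F) : (secantFree (Set.range D)).Nonempty := by
  have hns : ¬Function.Surjective D := by
    intro hs
    have := Fintype.card_le_of_surjective D hs
    rw [Fintype.card_fin, card_onePoint] at this
    omega
  rw [← Set.range_eq_univ, ← ne_eq, Set.ne_univ_iff_exists_notMem] at hns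
  obtain ⟨δ, hδ⟩ := hns
  exact ⟨conicPoint δ, (conicPoint_mem_secantFree_iff (range_nontrivial hD) δ).2 hδ⟩

variable [DecidableEq F]

/-- In characteristic `2` the nucleus is always on no secant, so no bound on `k` is needed. -/
theorem deepHoleSyndromes_of_even [CharP F 2] (hD : Function.Injective D) :
    deepHoleSyndromes 3 k D = O1D (Set.range D) ∪ O3D 1 (Set.range D) := by
  rw [deepHoleSyndromes_eq_secantFree hD ⟨_, nucleus_mem_secantFree _⟩,
    secantFree_eq_of_even (range_nontrivial hD)]

theorem deepHoleSyndromes_of_odd (hF : ringChar F ≠ 2) {ε : F} (hε : ¬IsSquare ε)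
    (hD : Function.Injective D) (h : k + 3 ≤ Fintype.card F) :
    deepHoleSyndromes 3 k D =
      O1D (Set.range D) ∪ O2D (Set.range D) ∪ O3D ε (Set.range D) := by
  rw [deepHoleSyndromes_eq_secantFree hD (secantFree_nonempty_of_add_three_le hD h),
    secantFree_eq_of_odd hF hε (range_nontrivial hD)]

theorem deepHoleSyndromes_eq_O2_union_O3 (hF : ringChar F ≠ 2) {ε : F} (hε : ¬IsSquare ε)
    (hk : 2 ≤ k) (hD : Function.Injective D) (h : k + 2 = Fintype.card F) :
    deepHoleSyndromes 3 k D = O2 F ∪ O3 ε := by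
  have hbij := bijective_of_add_two_eq hD h
  have hempty : secantFree (Set.range D) = ∅ := by
    have hodd : ¬Even (Fintype.card F) := by
      rw [Nat.even_iff, FiniteField.odd_card_of_char_ne_two hF]; simp
    rw [secantFree_eq_of_odd hF hε (range_nontrivial hD),
      O2D_eq_empty (Ring.two_ne_zero hF) hD (by omega), O3D_eq_empty hε hD (by omega),
      hbij.2.range_eq]
    simp [O1D, hodd]
  rw [deepHoleSyndromes_eq_compl_conic hbij hempty]
  have hε0 : ε ≠ 0 := by rintro rfl; exact hε (IsSquare.zero)
  refine Set.Subset.antisymm (fun P hP => ?_) ?_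
  · exact (mem_conic_or_mem_O2_or_mem_O3 hF hε P).resolve_left hP
  · exact Set.union_subset disjoint_O2_conic.subset_compl_right
      (disjoint_O3_conic hε0).subset_compl_right

end Determination

end RSDeepHoles

theorem mainTheorem4 {F : Type*} [Field F] [Fintype F] [DecidableEq F]
    (q : ℕ) (hq : q = Fintype.card F) (k : ℕ) (hk : 2 ≤ k)
    (D : Fin (k + 3) → OnePoint F) (hD : Function.Injective D) :
    (∀ u : Fin (k + 3) → F, RSDeepHoles.IsDeepHole (RSDeepHoles.rsCode k D) u →
      RSDeepHoles.syndrome 3 D u ≠ 0) ∧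
    (Even q → k + 2 = q →
      RSDeepHoles.deepHoleSyndromes 3 k D = {RSDeepHoles.nucleus F}) ∧
    (Odd q → k + 2 = q → ∀ ε : F, ¬ IsSquare ε →
      RSDeepHoles.deepHoleSyndromes 3 k D = RSDeepHoles.O2 F ∪ RSDeepHoles.O3 ε) ∧
    (k + 3 ≤ q → (q - 1) / 2 ≤ k →
      RSDeepHoles.deepHoleSyndromes 3 k D = RSDeepHoles.O1D (Set.range D)) ∧
    (Odd q → 2 * k + 3 = q →
      RSDeepHoles.deepHoleSyndromes 3 k D =
        RSDeepHoles.O1D (Set.range D) ∪ RSDeepHoles.O2D (Set.range D)) ∧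
    (Odd q → 2 * k + 5 ≤ q → ∀ ε : F, ¬ IsSquare ε →
      RSDeepHoles.deepHoleSyndromes 3 k D =
        RSDeepHoles.O1D (Set.range D) ∪ RSDeepHoles.O2D (Set.range D) ∪
          RSDeepHoles.O3D ε (Set.range D)) ∧
    (Even q → 2 * k + 4 ≤ q →
      RSDeepHoles.deepHoleSyndromes 3 k D =
        RSDeepHoles.O1D (Set.range D) ∪ RSDeepHoles.O4D (Set.range D)) := by
  open RSDeepHoles in
  subst hq
  have hodd : Odd (Fintype.card F) → ringChar F ≠ 2 := by
    rw [Nat.odd_iff, ne_eq, FiniteField.even_card_iff_char_two]; omega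
  have heven : Even (Fintype.card F) → CharP F 2 := by
    rw [Nat.even_iff, ← FiniteField.even_card_iff_char_two]
    exact ringChar.of_eq
  refine ⟨fun u => syndrome_ne_zero_of_isDeepHole hD, fun hF h => ?_, fun hF h ε hε => ?_,
    fun h h' => ?_, fun hF h => ?_, fun hF h ε hε => ?_, fun hF h => ?_⟩
  · have := heven hF
    rw [deepHoleSyndromes_of_even hD, O3D_one_eq_empty hD (by omega),
      (bijective_of_add_two_eq hD h).2.range_eq]
    simp [O1D, hF]
  · exact deepHoleSyndromes_eq_O2_union_O3 (hodd hF) hε hk hD h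
  · rcases Nat.even_or_odd (Fintype.card F) with hF | hF
    · have := heven hF
      obtain ⟨m, hm⟩ := hF
      rw [deepHoleSyndromes_of_even hD, O3D_one_eq_empty hD (by omega), Set.union_empty]
    · obtain ⟨ε, hε⟩ := FiniteField.exists_nonsquare (hodd hF)
      rw [deepHoleSyndromes_of_odd (hodd hF) hε hD h,
        O2D_eq_empty (Ring.two_ne_zero (hodd hF)) hD (by omega),
        O3D_eq_empty hε hD (by omega), Set.union_empty, Set.union_empty]
  · obtain ⟨ε, hε⟩ := FiniteField.exists_nonsquare (hodd hF)
    rw [deepHoleSyndromes_of_odd (hodd hF) hε hD (by omega), O3D_eq_empty hε hD (by omega),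
      Set.union_empty]
  · exact deepHoleSyndromes_of_odd (hodd hF) hε hD (by omega)
  · have := heven hF
    rw [deepHoleSyndromes_of_even hD, O4D_eq_O3D]
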